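/- **Setting.** Let $X$ be a random element of a measurable space $S$ with distribution $P$, let $\Theta\subseteq\mathbb R^d$ be open, and let $\ell(\theta,\cdot):S\to\mathbb R$, $\theta\in\Theta$, be measurable with $\mathbb E|\ell(\theta,X)|<\infty$. Put $L(\theta)=\mathbb E\,\ell(\theta,X)$ and assume that $L$ attains its minimum over $\Theta$ at a unique point $\theta_0\in\Theta$. Let $(k_j)_{j\ge1}$ and $(n_j)_{j\ge1}$ be non-decreasing sequences of integers converging to $\infty$ and $N_j=k_jn_j$. The $j$-th data set consists of $N_j$ observations, at most $\mathcal O_j$ of which are adversarial outliers: a fixed set of positions may be reserved for outliers, the entries in the other positions are i.i.d. with distribution $P$, and an adversary who has inspected the data fills the reserved positions and may overwrite some of the other entries, with arbitrary values, the total number of reserved and overwritten positions being at most $\mathcal O_j$. The index set $\{1,\dots,N_j\}$ is partitioned into $k_j$ disjoint groups $G_1,\dots,G_{k_j}$ of cardinality $n_j$, and $\bar L_i(\theta)$ denotes the average of $\ell(\theta,\cdot)$ over the observations in $G_i$. Let $(\Delta_n)_{n\ge1}$ be positive numbers with $\Delta_n=o(\sqrt n)$ such that $\lim_n\Delta_n\in(0,\infty]$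 exists. With $n=n_j$, $k=k_j$, let $$\widehat L(\theta)\in\operatorname*{argmin}_{z\in\mathbb R}\sum_{i=1}^k\rho\Big(\sqrt n\,\frac{\bar L_i(\theta)-z}{\Delta_n}\Big),\qquad \widehat L(\theta,\theta')\in\operatorname*{argmin}_{z\in\mathbb R}\sum_{i=1}^k\rho\Big(\sqrt n\,\frac{\bar L_i(\theta)-\bar L_i(\theta')-z}{\Delta_n}\Big)$$ (any choice of the minimizers), let $\widehat\theta_{n_j,k_j}\in\operatorname{argmin}_{\theta\in\Theta}\widehat L(\theta)$, and let $\big(\widehat\theta^{(1)}_{n_j,k_j},\widehat\theta^{(2)}_{n_j,k_j}\big)$ solve $\min_{\theta\in\Theta}\max_{\theta'\in\Theta}\widehat L(\theta,\theta')$, that is, $\widehat\theta^{(1)}$ minimizes $\theta\mapsto\sup_{\theta'\in\Theta}\widehat L(\theta,\theta')$ and $\widehat\theta^{(2)}$ maximizes $\theta'\mapsto\widehat L(\widehat\theta^{(1)},\theta')$ over $\Theta$; these optima are assumed to be attained. **Assumptions.** 1. $\rho:\mathbb R\to\mathbb R$ is convex and even; $\rho'(z)=z$ for $|z|\le1$ and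 $\rho'$ is constant on $[2,\infty)$; $z-\rho'(z)$ is nondecreasing; $\rho^{(5)}$ exists and is bounded and Lipschitz continuous. 2. $L$ is twice differentiable at $\theta_0$ and its Hessian there is positive definite. 3. For every $\theta\in\Theta$ there are a ball $B(\theta,r(\theta))$, $r(\theta)>0$, and a measurable function $M_\theta$ with $\mathbb E M_\theta^2(X)<\infty$ such that $|\ell(\theta',x)-\ell(\theta'',x)|\le M_\theta(x)\|\theta'-\theta''\|$ for all $x\in S$ and $\theta',\theta''\in B(\theta,r(\theta))\cap\Theta$. Moreover, for every $\theta\in\Theta$, the map $\theta'\mapsto\ell(\theta',x)$ is differentiable at $\theta$ for $P$-almost all $x$. 4. For $A\subseteq\Theta$ let $B(n,A,t)=\Pr\big(\inf_{\theta\in A}\frac1n\sum_{i=1}^n\ell(\theta,X_i)<L(\theta_0)+t\big)$, where $X_1,\dots,X_n$ are i.i.d. with distribution $P$ and $\inf\emptyset=+\infty$. (a) For some $t>0$, $\lim_{R\to\infty}\limsup_{n\to\infty}B(n,\{\theta\in\Theta:\|\theta-\theta_0\|\ge R\},t)=0$. (b) For every $R>0$ there is $t>0$ such that for every $\varepsilon>0$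 there is a compact $K\subset\Theta$ with $\limsup_{n\to\infty}B(n,\{\theta\in\Theta\setminus K:\|\theta-\theta_0\|\le R\},t)\le\varepsilon$. (Part (b) holds automatically if $\Theta=\mathbb R^d$.) **Theorem.** There is an absolute constant $c>0$ such that, in the setting and under the assumptions above, if $\limsup_{j\to\infty}\mathcal O_j/k_j\le c$, then: (i) if moreover $\operatorname{Var}\ell(\theta,X)<\infty$ for all $\theta\in\Theta$, then $\widehat\theta_{n_j,k_j}\to\theta_0$ in probability as $j\to\infty$; (ii) without this additional condition, $\widehat\theta^{(1)}_{n_j,k_j}\to\theta_0$ and $\widehat\theta^{(2)}_{n_j,k_j}\to\theta_0$ in probability as $j\to\infty$. -/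

import Mathlib

open MeasureTheory ProbabilityTheory Filter Topology
open scoped NNReal ENNReal

namespace RobustMEst

noncomputable section

/-- The requirements on the loss `ρ` used to build robust proxies of the mean. -/
structure AdmissibleRho (ρ : ℝ → ℝ) : Prop where
  convex : ConvexOn ℝ Set.univ ρ
  even : ∀ z, ρ (-z) = ρ z
  smooth : ContDiff ℝ 5 ρ
  deriv_eq_self : ∀ z, |z| ≤ 1 → deriv ρ z = z
  deriv_const : ∃ C, ∀ z, 2 ≤ z → deriv ρ z = C
  mono_sub_deriv : Monotone fun z => z - deriv ρ z
  fifth_bounded : ∃ C, ∀ z, |iteratedDeriv 5 ρ z| ≤ C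
  fifth_lipschitz : ∃ K : ℝ≥0, LipschitzWith K (iteratedDeriv 5 ρ)

/-- The scaling factors: positive, `Δ n = o(√n)`, with a limit in `(0, ∞]`. -/
structure AdmissibleScaling (Δ : ℕ → ℝ) : Prop where
  pos : ∀ n, 1 ≤ n → 0 < Δ n
  isLittleO : Δ =o[atTop] fun n : ℕ => √(n : ℝ)
  limit : (∃ D, 0 < D ∧ Tendsto Δ atTop (𝓝 D)) ∨ Tendsto Δ atTop atTop

/-- `f` is twice (Fréchet) differentiable at `x` and its Hessian there is positive definite. -/
def HasPosDefHessianAt {d : ℕ} (f : EuclideanSpace ℝ (Fin d) → ℝ)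
    (x : EuclideanSpace ℝ (Fin d)) : Prop :=
  (∀ᶠ y in 𝓝 x, DifferentiableAt ℝ f y) ∧ DifferentiableAt ℝ (fderiv ℝ f) x ∧
    ∀ v, v ≠ 0 → 0 < fderiv ℝ (fderiv ℝ f) x v v

section Model

variable {d : ℕ} {S : Type*} [MeasurableSpace S]

/-- The risk `L(θ) = 𝔼 ℓ(θ, X)`, `X ∼ P`. -/
def risk (P : Measure S) (ℓ : EuclideanSpace ℝ (Fin d) → S → ℝ)
    (θ : EuclideanSpace ℝ (Fin d)) : ℝ :=
  ∫ x, ℓ θ x ∂P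

/-- The loss is locally Lipschitz in the parameter with an envelope that has `2 + τ` moments, and
for each `θ ∈ Θ` it is `P`-almost surely differentiable at `θ`. -/
structure LipschitzLoss (P : Measure S) (Θ : Set (EuclideanSpace ℝ (Fin d)))
    (ℓ : EuclideanSpace ℝ (Fin d) → S → ℝ) (τ : ℝ) : Prop where
  lipschitz : ∀ θ ∈ Θ, ∃ r > 0, ∃ M : S → ℝ, Measurable M ∧
    Integrable (fun x => |M x| ^ (2 + τ)) P ∧
    ∀ θ' ∈ Metric.ball θ r ∩ Θ, ∀ θ'' ∈ Metric.ball θ r ∩ Θ, ∀ x,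
      |ℓ θ' x - ℓ θ'' x| ≤ M x * ‖θ' - θ''‖
  differentiable : ∀ θ ∈ Θ, ∀ᵐ x ∂P, DifferentiableAt ℝ (fun θ' => ℓ θ' x) θ

/-- The probability that, over an i.i.d. sample of size `n` from `P`, the infimum over `θ ∈ A` of
the empirical risk is smaller than `L(θ₀) + t`. The infimum is taken in the extended reals, so it
is `+∞` when `A` is empty. -/
def lowRiskProb (P : Measure S) (ℓ : EuclideanSpace ℝ (Fin d) → S → ℝ)
    (θ₀ : EuclideanSpace ℝ (Fin d)) (n : ℕ) (A : Set (EuclideanSpace ℝ (Fin d))) (t : ℝ) : ℝ≥0∞ :=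
  Measure.pi (fun _ : Fin n => P)
    {x | (⨅ θ ∈ A, (((∑ i, ℓ θ (x i)) / n : ℝ) : EReal)) < ((risk P ℓ θ₀ + t : ℝ) : EReal)}

/-- For some `t > 0`, `lim_{R → ∞} limsup_{n → ∞}` of the probability that the empirical risk drops
below `L(θ₀) + t` somewhere at distance at least `R` from `θ₀` is zero. -/
def NoEscapeToInfinity (P : Measure S) (Θ : Set (EuclideanSpace ℝ (Fin d)))
    (ℓ : EuclideanSpace ℝ (Fin d) → S → ℝ) (θ₀ : EuclideanSpace ℝ (Fin d)) : Prop :=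
  ∃ t > 0, Tendsto
    (fun R : ℝ => limsup (fun n : ℕ => lowRiskProb P ℓ θ₀ n {θ ∈ Θ | R ≤ ‖θ - θ₀‖} t) atTop)
    atTop (𝓝 0)

/-- The same requirement at the finite part of the boundary of the open set `Θ`; it is void when
the bounded closed balls around `θ₀` meet `Θ` in compact sets, in particular when `Θ` is the whole
space. -/
def NoEscapeToBoundary (P : Measure S) (Θ : Set (EuclideanSpace ℝ (Fin d)))
    (ℓ : EuclideanSpace ℝ (Fin d) → S → ℝ) (θ₀ : EuclideanSpace ℝ (Fin d)) : Prop :=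
  ∀ R > 0, ∃ t > 0, ∀ ε > 0, ∃ K ⊆ Θ, IsCompact K ∧
    limsup (fun n : ℕ => lowRiskProb P ℓ θ₀ n {θ ∈ Θ | ‖θ - θ₀‖ ≤ R ∧ θ ∉ K} t) atTop ≤ ε

/-- `Y` is a sample from `P` of which at most `m` entries are adversarial outliers. The slots in
`A` are occupied by outliers from the start; the entries `X i` with `i ∉ A` are i.i.d. from `P`, and
the adversary, who sees everything, may overwrite some of them. The outliers are arbitrary functions
of the randomness, and their total number is at most `m`. -/
def IsContaminatedSample {Ω : Type*} [MeasurableSpace Ω] (μ : Measure Ω) (P : Measure S) {N : ℕ}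
    (m : ℕ) (Y : Fin N → Ω → S) : Prop :=
  ∃ (A : Set (Fin N)) (X : Fin N → Ω → S),
    (∀ i ∉ A, Measurable (X i) ∧ μ.map (X i) = P) ∧
    iIndepFun (fun i : {i // i ∉ A} => X i) μ ∧
    ∀ᵐ ω ∂μ, {i | i ∈ A ∨ Y i ω ≠ X i ω}.ncard ≤ m

end Model

section Estimators

variable {d : ℕ} {S : Type*}

/-- The empirical risk `L̄(θ)` over a subsample `G` of cardinality `n`. -/
def blockRisk {N : ℕ} (ℓ : EuclideanSpace ℝ (Fin d) → S → ℝ) (n : ℕ) (G : Finset (Fin N))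
    (y : Fin N → S) (θ : EuclideanSpace ℝ (Fin d)) : ℝ :=
  (∑ i ∈ G, ℓ θ (y i)) / n

/-- The set `argmin_z ∑ j, ρ (√n (a j - z) / δ)`. -/
def robustMean {k : ℕ} (ρ : ℝ → ℝ) (n : ℕ) (δ : ℝ) (a : Fin k → ℝ) : Set ℝ :=
  {z | ∀ w, ∑ j, ρ (√(n : ℝ) * ((a j - z) / δ)) ≤ ∑ j, ρ (√(n : ℝ) * ((a j - w) / δ))}

/-- `θ̂` minimizes over `Θ` (some version of) the robust proxy `L̂(θ)` of the risk, computed from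
the data `y` grouped into the blocks `G j` of cardinality `n`. -/
def IsRobustERM {N k : ℕ} (ρ : ℝ → ℝ) (n : ℕ) (δ : ℝ) (Θ : Set (EuclideanSpace ℝ (Fin d)))
    (ℓ : EuclideanSpace ℝ (Fin d) → S → ℝ) (G : Fin k → Finset (Fin N)) (y : Fin N → S)
    (θhat : EuclideanSpace ℝ (Fin d)) : Prop :=
  ∃ F : EuclideanSpace ℝ (Fin d) → ℝ,
    (∀ θ ∈ Θ, F θ ∈ robustMean ρ n δ fun j => blockRisk ℓ n (G j) y θ) ∧
    θhat ∈ Θ ∧ IsMinOn F Θ θhat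

/-- `(θ₁, θ₂)` solves `min_{θ ∈ Θ} max_{θ' ∈ Θ} L̂(θ, θ')` for (some version of) the robust proxy
`L̂(θ, θ')` of `L(θ) - L(θ')`. -/
def IsRobustMinMax {N k : ℕ} (ρ : ℝ → ℝ) (n : ℕ) (δ : ℝ) (Θ : Set (EuclideanSpace ℝ (Fin d)))
    (ℓ : EuclideanSpace ℝ (Fin d) → S → ℝ) (G : Fin k → Finset (Fin N)) (y : Fin N → S)
    (θ₁ θ₂ : EuclideanSpace ℝ (Fin d)) : Prop :=
  ∃ F : EuclideanSpace ℝ (Fin d) → EuclideanSpace ℝ (Fin d) → ℝ,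
    (∀ θ ∈ Θ, ∀ θ' ∈ Θ, F θ θ' ∈
      robustMean ρ n δ fun j => blockRisk ℓ n (G j) y θ - blockRisk ℓ n (G j) y θ') ∧
    θ₁ ∈ Θ ∧ θ₂ ∈ Θ ∧
    IsMinOn (fun θ => ⨆ θ' ∈ Θ, (F θ θ' : EReal)) Θ θ₁ ∧ IsMaxOn (F θ₁) Θ θ₂

end Estimators

end

end RobustMEst

namespace RobustMEst

/-! ### The robust mean against a majority of the entries -/

section RobustMean

variable {ρ : ℝ → ℝ}

/-! The argument treats the robust mean like a median. Since `ρ'` is odd, monotone and constant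
beyond 2, the robust mean cannot leave the range of a strict majority of its entries by more than
`2Δ/√n`, which tends to 0 (`robustMean_le`, `le_robustMean`). So it suffices to control most blocks,
simultaneously in `θ`.

Call a block bad if its empirical risk deviates from `L` by more than `ε` somewhere on a compact
`K`, or falls below `L(θ₀) + t` somewhere outside a compact `K₀ ⊆ K`. For a clean block this has
small probability, by a uniform law of large numbers on `K` and by the two no-escape conditions off
`K₀`. By Markov's inequality fewer than a quarter of the clean blocks are bad, with high
probability; outliers spoil at most another quarter. Only the law of each single block enters, not
the independence between blocks.

On the remaining strict majority every block risk has a well at `θ₀` (`HasMajorityWell`). The well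
transfers to the robust proxies, and comparison with `θ₀` (or with `θ₁` for the second min-max
coordinate) confines the estimators. The estimators need not be measurable: all events are bounded
in outer measure. -/

theorem AdmissibleRho.differentiable (hρ : AdmissibleRho ρ) : Differentiable ℝ ρ :=
  hρ.smooth.differentiable (by norm_num)

theorem AdmissibleRho.deriv_neg (hρ : AdmissibleRho ρ) (z : ℝ) :
    deriv ρ (-z) = -deriv ρ z := by
  have h : (fun z => ρ (-z)) = ρ := funext hρ.even
  have h' := deriv_comp_neg ρ z
  rw [h] at h'
  linarith

theorem AdmissibleRho.monotone_deriv (hρ : AdmissibleRho ρ) : Monotone (deriv ρ) := by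
  have h := hρ.convex.monotoneOn_deriv fun x _ => hρ.differentiable x
  exact monotoneOn_univ.1 (by simpa using h)

/-- The score `ρ'` is bounded by a positive level, which it attains on `[2, ∞)`. -/
theorem AdmissibleRho.exists_bound (hρ : AdmissibleRho ρ) :
    ∃ C, 0 < C ∧ (∀ z, 2 ≤ z → deriv ρ z = C) ∧ ∀ z, |deriv ρ z| ≤ C := by
  obtain ⟨C, hC⟩ := hρ.deriv_const
  have hle : ∀ z, deriv ρ z ≤ C := fun z => by
    rw [← hC (max z 2) (le_max_right _ _)]
    exact hρ.monotone_deriv (le_max_left _ _)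
  refine ⟨C, ?_, hC, fun z => abs_le.2 ⟨?_, hle z⟩⟩
  · have := hle 1
    rw [hρ.deriv_eq_self 1 (by simp)] at this
    linarith
  · have := hle (-z)
    rw [hρ.deriv_neg] at this
    linarith

theorem sum_deriv_eq_zero_of_mem_robustMean (hρ : AdmissibleRho ρ) {k n : ℕ} {δ z : ℝ}
    {a : Fin k → ℝ} (hn : 1 ≤ n) (hδ : 0 < δ) (hz : z ∈ robustMean ρ n δ a) :
    ∑ i, deriv ρ (√(n : ℝ) * ((a i - z) / δ)) = 0 := by
  have hder : HasDerivAt (fun w => ∑ i, ρ (√(n : ℝ) * ((a i - w) / δ)))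
      (∑ i, deriv ρ (√(n : ℝ) * ((a i - z) / δ)) * (√(n : ℝ) * (-1 / δ))) z := by
    refine HasDerivAt.fun_sum fun i _ => ?_
    refine (hρ.differentiable _).hasDerivAt.comp z ?_
    exact (((hasDerivAt_id z).const_sub (a i)).div_const δ).const_mul _
  have hmin : IsLocalMin (fun w => ∑ i, ρ (√(n : ℝ) * ((a i - w) / δ))) z :=
    Eventually.of_forall hz
  have h0 := hmin.hasDerivAt_eq_zero hder
  rw [← Finset.sum_mul] at h0
  have hn' : 0 < √(n : ℝ) := Real.sqrt_pos.2 (by exact_mod_cast hn)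
  refine (mul_eq_zero.1 h0).resolve_right (mul_ne_zero hn'.ne' ?_)
  exact div_ne_zero (by norm_num) hδ.ne'

/-- Evenness of `ρ`; this reduces lower bounds on the robust mean to upper bounds. -/
theorem robustMean_neg (hρ : AdmissibleRho ρ) {k n : ℕ} {δ z : ℝ} {a : Fin k → ℝ}
    (hz : z ∈ robustMean ρ n δ a) : -z ∈ robustMean ρ n δ (fun i => -a i) := by
  have key : ∀ w, ∑ i, ρ (√(n : ℝ) * ((-a i - w) / δ)) =
      ∑ i, ρ (√(n : ℝ) * ((a i - -w) / δ)) := fun w =>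
    Finset.sum_congr rfl fun i _ => by
      rw [← hρ.even]
      congr 1
      ring
  intro w
  rw [key, key, neg_neg]
  exact hz _

/-- If a strict majority of the entries are at most `b`, then the robust mean exceeds `b` by at
most twice the width of the window. -/
theorem robustMean_le (hρ : AdmissibleRho ρ) {k n : ℕ} {δ z b : ℝ} {a : Fin k → ℝ}
    (hn : 1 ≤ n) (hδ : 0 < δ) (hz : z ∈ robustMean ρ n δ a) {s : Finset (Fin k)}
    (hs : k < 2 * s.card) (hb : ∀ i ∈ s, a i ≤ b) : z ≤ b + 2 * (δ / √(n : ℝ)) := by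
  by_contra! hlt
  obtain ⟨C, hC, hC2, hCb⟩ := hρ.exists_bound
  have hn' : 0 < √(n : ℝ) := Real.sqrt_pos.2 (by exact_mod_cast hn)
  have h0 := sum_deriv_eq_zero_of_mem_robustMean hρ hn hδ hz
  rw [← Finset.sum_add_sum_compl s] at h0
  -- If `z` were too large, the score would saturate at `-C` on the majority, and the minority,
  -- contributing at most `C` each, could not restore the sum to 0.
  have h1 : ∑ i ∈ s, deriv ρ (√(n : ℝ) * ((a i - z) / δ)) ≤ ∑ _i ∈ s, (-C) := by
    refine Finset.sum_le_sum fun i hi => ?_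
    have h2 : 2 ≤ √(n : ℝ) * ((z - a i) / δ) := by
      have h3 : 2 * (δ / √(n : ℝ)) ≤ z - a i := by linarith [hb i hi]
      calc (2 : ℝ) = √(n : ℝ) * (2 * (δ / √(n : ℝ)) / δ) := by field_simp
        _ ≤ _ := by gcongr
    have h3 : √(n : ℝ) * ((a i - z) / δ) = -(√(n : ℝ) * ((z - a i) / δ)) := by ring
    rw [h3, hρ.deriv_neg, hC2 _ h2]
  have h2 : ∑ i ∈ sᶜ, deriv ρ (√(n : ℝ) * ((a i - z) / δ)) ≤ ∑ _i ∈ sᶜ, C :=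
    Finset.sum_le_sum fun i _ => (abs_le.1 (hCb _)).2
  simp only [Finset.sum_const, nsmul_eq_mul] at h1 h2
  have hcard : (s.card : ℝ) + (sᶜ.card : ℝ) = k := by
    have := Finset.card_add_card_compl s
    rw [Fintype.card_fin] at this
    exact_mod_cast this
  have hs' : (k : ℝ) < 2 * s.card := by exact_mod_cast hs
  nlinarith

theorem le_robustMean (hρ : AdmissibleRho ρ) {k n : ℕ} {δ z b : ℝ} {a : Fin k → ℝ}
    (hn : 1 ≤ n) (hδ : 0 < δ) (hz : z ∈ robustMean ρ n δ a) {s : Finset (Fin k)}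
    (hs : k < 2 * s.card) (hb : ∀ i ∈ s, b ≤ a i) : b - 2 * (δ / √(n : ℝ)) ≤ z := by
  have := robustMean_le hρ hn hδ (robustMean_neg hρ hz) hs fun i hi => neg_le_neg (hb i hi)
  linarith

end RobustMean

/-! ### Weak law for product measures -/

section LawOfLargeNumbers

variable {S : Type*} [MeasurableSpace S]

theorem map_eq_pi_of_iIndepFun {Ω ι : Type*} [Fintype ι] [MeasurableSpace Ω] {μ : Measure Ω}
    [IsProbabilityMeasure μ] {P : Measure S} {X : ι → Ω → S} (hX : ∀ i, Measurable (X i))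
    (hP : ∀ i, μ.map (X i) = P) (hind : iIndepFun X μ) :
    μ.map (fun ω i => X i ω) = Measure.pi fun _ => P := by
  rw [(iIndepFun_iff_map_fun_eq_pi_map fun i => (hX i).aemeasurable).1 hind]
  simp_rw [hP]

/-- The weak law of large numbers for the product measures. -/
theorem tendsto_pi_average_sub_integral (P : Measure S) [IsProbabilityMeasure P] {f : S → ℝ}
    (hf : Measurable f) (hfi : Integrable f P) {ε : ℝ} (hε : 0 < ε) :
    Tendsto (fun n : ℕ => Measure.pi (fun _ : Fin n => P)
      {x | ε < |(∑ i, f (x i)) / n - ∫ y, f y ∂P|}) atTop (𝓝 0) := by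
  -- All sample sizes are realized on one infinite product, where the strong law applies; the finite
  -- products are its marginals.
  set Q : Measure (ℕ → S) := Measure.infinitePi fun _ => P
  have hmap : ∀ i, Q.map (fun ω => ω i) = P := fun i => Measure.infinitePi_map_eval _ i
  have hindS : iIndepFun (fun (i : ℕ) (ω : ℕ → S) => ω i) Q :=
    iIndepFun_infinitePi (X := fun _ x => x) fun _ => measurable_id
  have hind : iIndepFun (fun (i : ℕ) (ω : ℕ → S) => f (ω i)) Q :=
    iIndepFun_infinitePi (X := fun _ => f) fun _ => hf
  have hint : Integrable (fun ω : ℕ → S => f (ω 0)) Q := by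
    have : Integrable f (Q.map fun ω => ω 0) := by rwa [hmap]
    exact this.comp_measurable (measurable_pi_apply 0)
  have hE : ∫ ω, f (ω 0) ∂Q = ∫ y, f y ∂P := by
    rw [← hmap 0, integral_map (measurable_pi_apply 0).aemeasurable hf.aestronglyMeasurable]
  have hslln := strong_law_ae_real (fun i (ω : ℕ → S) => f (ω i)) hint
    (fun i j hij => hind.indepFun hij) fun i =>
      ⟨(hf.comp (measurable_pi_apply i)).aemeasurable,
        (hf.comp (measurable_pi_apply 0)).aemeasurable, by
          rw [← Function.comp_def f, ← Function.comp_def f,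
            ← Measure.map_map hf (measurable_pi_apply i),
            ← Measure.map_map hf (measurable_pi_apply 0), hmap, hmap]⟩
  have hmeas : ∀ n : ℕ, Measurable fun ω : ℕ → S => (∑ i ∈ Finset.range n, f (ω i)) / n :=
    fun n => (Finset.measurable_sum _ fun i _ => hf.comp (measurable_pi_apply i)).div_const _
  have hin := tendstoInMeasure_of_tendsto_ae (fun n => (hmeas n).aestronglyMeasurable) hslln
  have h0 := tendstoInMeasure_iff_dist.1 hin ε hε
  refine tendsto_of_tendsto_of_tendsto_of_le_of_le tendsto_const_nhds h0 (fun _ => zero_le)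
    fun n => ?_
  have hpi : Q.map (fun ω (i : Fin n) => ω i) = Measure.pi fun _ => P :=
    map_eq_pi_of_iIndepFun (X := fun (i : Fin n) (ω : ℕ → S) => ω i)
      (fun i => measurable_pi_apply _) (fun i => hmap i) (hindS.precomp Fin.val_injective)
  have hset : MeasurableSet {x : Fin n → S | ε < |(∑ i, f (x i)) / n - ∫ y, f y ∂P|} := by
    refine measurableSet_lt measurable_const (Measurable.abs (Measurable.sub_const ?_ _))
    exact (Finset.measurable_sum _ fun i _ => hf.comp (measurable_pi_apply i)).div_const _
  simp only
  rw [← hpi, Measure.map_apply (measurable_pi_lambda _ fun i => measurable_pi_apply _) hset]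
  refine measure_mono fun ω hω => ?_
  simp only [Set.mem_preimage, Set.mem_ofPred_eq] at hω ⊢
  rw [Real.dist_eq, hE, Finset.sum_range fun i => f (ω i)]
  exact hω.le

end LawOfLargeNumbers

/-! ### Uniform law of large numbers on compact sets -/

section UniformLaw

variable {d : ℕ} {S : Type*} [MeasurableSpace S]

/-- The loss is Lipschitz near each point of `Θ`, with an integrable envelope. -/
theorem LipschitzLoss.exists_integrable_envelope {P : Measure S} [IsProbabilityMeasure P]
    {Θ : Set (EuclideanSpace ℝ (Fin d))} {ℓ : EuclideanSpace ℝ (Fin d) → S → ℝ}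
    (h : LipschitzLoss P Θ ℓ 0) {θ : EuclideanSpace ℝ (Fin d)} (hθ : θ ∈ Θ) :
    ∃ r > 0, ∃ M : S → ℝ, Measurable M ∧ Integrable M P ∧ (∀ x, 0 ≤ M x) ∧
      ∀ θ' ∈ Metric.ball θ r ∩ Θ, ∀ x, |ℓ θ' x - ℓ θ x| ≤ M x * ‖θ' - θ‖ := by
  obtain ⟨r, hr, M, hM, hint, hlip⟩ := h.lipschitz θ hθ
  refine ⟨r, hr, fun x => |M x|, hM.abs, ?_, fun x => abs_nonneg _, fun θ' hθ' x => ?_⟩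
  · refine ((integrable_const 1).add hint).mono' hM.abs.aestronglyMeasurable
      (Eventually.of_forall fun x => ?_)
    simp only [add_zero, Real.rpow_two, sq_abs, Real.norm_eq_abs, abs_abs, Pi.add_apply]
    nlinarith [sq_nonneg (|M x| - 1), sq_abs (M x)]
  · refine (hlip θ' hθ' θ ⟨Metric.mem_ball_self hr, hθ⟩ x).trans ?_
    gcongr
    exact le_abs_self _

theorem abs_risk_sub_le {P : Measure S} {ℓ : EuclideanSpace ℝ (Fin d) → S → ℝ}
    {θ θ' : EuclideanSpace ℝ (Fin d)} {M : S → ℝ} (hθ : Integrable (ℓ θ) P)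
    (hθ' : Integrable (ℓ θ') P) (hM : Integrable M P)
    (h : ∀ x, |ℓ θ' x - ℓ θ x| ≤ M x * ‖θ' - θ‖) :
    |risk P ℓ θ' - risk P ℓ θ| ≤ (∫ x, M x ∂P) * ‖θ' - θ‖ := by
  rw [risk, risk, ← integral_sub hθ' hθ, ← integral_mul_const]
  exact abs_integral_le_integral_abs.trans
    (integral_mono (hθ'.sub hθ).abs (hM.mul_const _) h)

theorem LipschitzLoss.continuousOn_risk {P : Measure S} [IsProbabilityMeasure P]
    {Θ : Set (EuclideanSpace ℝ (Fin d))} {ℓ : EuclideanSpace ℝ (Fin d) → S → ℝ}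
    (h : LipschitzLoss P Θ ℓ 0) (hint : ∀ θ ∈ Θ, Integrable (ℓ θ) P) :
    ContinuousOn (risk P ℓ) Θ := by
  intro θ hθ
  obtain ⟨r, hr, M, -, hMi, -, hlip⟩ := h.exists_integrable_envelope hθ
  refine tendsto_iff_dist_tendsto_zero.2 ?_
  have hlim : Tendsto (fun θ' => (∫ x, M x ∂P) * ‖θ' - θ‖) (𝓝[Θ] θ) (𝓝 0) := by
    have : Continuous fun θ' => (∫ x, M x ∂P) * ‖θ' - θ‖ := by fun_prop
    simpa using (this.tendsto θ).mono_left nhdsWithin_le_nhds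
  refine squeeze_zero' (Eventually.of_forall fun _ => dist_nonneg) ?_ hlim
  filter_upwards [self_mem_nhdsWithin, mem_nhdsWithin_of_mem_nhds (Metric.ball_mem_nhds θ hr)]
    with θ' hθ' hball
  rw [Real.dist_eq]
  exact abs_risk_sub_le (hint θ hθ) (hint θ' hθ') hMi (hlip θ' ⟨hball, hθ'⟩)

theorem abs_average_sub_le {T : Type*} {n : ℕ} {f g M : T → ℝ} {c : ℝ}
    (h : ∀ x, |f x - g x| ≤ M x * c) (x : Fin n → T) :
    |(∑ i, f (x i)) / n - (∑ i, g (x i)) / n| ≤ (∑ i, M (x i)) / n * c := by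
  rw [← sub_div, ← Finset.sum_sub_distrib, abs_div, Nat.abs_cast, div_mul_eq_mul_div,
    Finset.sum_mul]
  gcongr
  exact (Finset.abs_sum_le_sum_abs _ _).trans (Finset.sum_le_sum fun i _ => h _)

/-- The uniform weak law of large numbers on compact subsets of the parameter set. -/
theorem LipschitzLoss.tendsto_pi_uniform_deviation {P : Measure S} [IsProbabilityMeasure P]
    {Θ : Set (EuclideanSpace ℝ (Fin d))} {ℓ : EuclideanSpace ℝ (Fin d) → S → ℝ}
    (h : LipschitzLoss P Θ ℓ 0) (hmeas : ∀ θ ∈ Θ, Measurable (ℓ θ))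
    (hint : ∀ θ ∈ Θ, Integrable (ℓ θ) P) {K : Set (EuclideanSpace ℝ (Fin d))}
    (hK : IsCompact K) (hKΘ : K ⊆ Θ) {ε : ℝ} (hε : 0 < ε) :
    Tendsto (fun n : ℕ => Measure.pi (fun _ : Fin n => P)
      {x | ∃ θ ∈ K, ε < |(∑ i, ℓ θ (x i)) / n - risk P ℓ θ|}) atTop (𝓝 0) := by
  have squeeze : ∀ {u v : ℕ → ℝ≥0∞}, Tendsto v atTop (𝓝 0) → (∀ n, u n ≤ v n) →
      Tendsto u atTop (𝓝 0) := fun hv huv =>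
    tendsto_of_tendsto_of_tendsto_of_le_of_le tendsto_const_nhds hv (fun _ => zero_le) huv
  -- The claim passes to subsets and finite unions, so by compactness it is enough to prove it near
  -- each point.
  refine hK.induction_on (p := fun K => Tendsto (fun n : ℕ => Measure.pi (fun _ : Fin n => P)
      {x | ∃ θ ∈ K, ε < |(∑ i, ℓ θ (x i)) / n - risk P ℓ θ|}) atTop (𝓝 0)) ?_ ?_ ?_ ?_
  · simp
  · intro s t hst ht
    exact squeeze ht fun n => measure_mono fun x ⟨θ, hθ, hx⟩ => ⟨θ, hst hθ, hx⟩
  · intro s t hs ht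
    refine squeeze (by simpa using hs.add ht) fun n => (measure_mono ?_).trans
      (measure_union_le _ _)
    rintro x ⟨θ, hθ | hθ, hx⟩
    · exact Or.inl ⟨θ, hθ, hx⟩
    · exact Or.inr ⟨θ, hθ, hx⟩
  · intro θ hθ
    obtain ⟨r, hr, M, hM, hMi, hM0, hlip⟩ := h.exists_integrable_envelope (hKΘ hθ)
    set m := ∫ x, M x ∂P
    have hm : 0 ≤ m := integral_nonneg hM0
    -- With the average of `M` at most `m + 1`, moving from `θ` to `θ'` changes the empirical risk
    -- and the risk by at most `ε / 4` each; the deviation at `θ` adds another `ε / 4`, which totals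
    -- less than `ε`.
    set s := min r (ε / (4 * (m + 1)))
    have hs : 0 < s := lt_min hr (by positivity)
    have hsε : s * (m + 1) ≤ ε / 4 := by
      have : s ≤ ε / (4 * (m + 1)) := min_le_right _ _
      rw [le_div_iff₀ (by positivity)] at this
      linarith
    refine ⟨Metric.ball θ s ∩ K, inter_mem (mem_nhdsWithin_of_mem_nhds
      (Metric.ball_mem_nhds θ hs)) self_mem_nhdsWithin, ?_⟩
    have h1 := tendsto_pi_average_sub_integral P (hmeas θ (hKΘ hθ)) (hint θ (hKΘ hθ))
      (ε := ε / 4) (by positivity)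
    have h2 := tendsto_pi_average_sub_integral P hM hMi one_pos
    refine squeeze (by simpa using h1.add h2) fun n => (measure_mono ?_).trans
      (measure_union_le _ _)
    rintro x ⟨θ', ⟨hball, hθ'K⟩, hx⟩
    by_contra hcon
    rw [Set.mem_union, not_or] at hcon
    obtain ⟨hc1, hc2⟩ := hcon
    simp only [Set.mem_ofPred_eq, not_lt] at hc1 hc2
    have hlip' := hlip θ' ⟨Metric.ball_subset_ball (min_le_left _ _) hball, hKΘ hθ'K⟩
    have hd : ‖θ' - θ‖ ≤ s := by
      rw [← dist_eq_norm]
      exact (Metric.mem_ball.1 hball).le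
    have e1 := abs_average_sub_le hlip' x
    have e2 := abs_risk_sub_le (hint θ (hKΘ hθ)) (hint θ' (hKΘ hθ'K)) hMi hlip'
    have e3 : (∑ i, M (x i)) / n ≤ m + 1 := by linarith [(abs_le.1 hc2).2]
    have e4 : (∑ i, M (x i)) / n * ‖θ' - θ‖ ≤ ε / 4 :=
      (mul_le_mul e3 hd (norm_nonneg _) (by positivity)).trans (by linarith)
    have e5 : m * ‖θ' - θ‖ ≤ ε / 4 :=
      (mul_le_mul (by linarith : m ≤ m + 1) hd (norm_nonneg _) (by positivity)).trans
        (by linarith)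
    change |(∑ i, ℓ θ (x i)) / n - risk P ℓ θ| ≤ ε / 4 at hc1
    rw [abs_le] at *
    rw [lt_abs] at hx
    rcases hx with hx | hx <;> linarith [hc1.1, hc1.2, e1.1, e1.2, e2.1, e2.2]

end UniformLaw

/-! ### Counting bad blocks under contamination -/

section Contamination

variable {S Ω : Type*} [MeasurableSpace S] [MeasurableSpace Ω]

/-- Markov's inequality for the number of indices `i` such that `ω ∈ E i`. -/
theorem measure_le_card_le {μ : Measure Ω} {ι : Type*} [Fintype ι] {E : ι → Set Ω}
    (hE : ∀ i, MeasurableSet (E i)) {p : ℝ≥0∞} (hp : ∀ i, μ (E i) ≤ p) {s : ℝ≥0∞}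
    (hs : s ≠ 0) (hs' : s ≠ ⊤) :
    μ {ω | s ≤ ({i | ω ∈ E i}.ncard : ℝ≥0∞)} ≤ Fintype.card ι * p / s := by
  classical
  have hcount : ∀ ω, ({i | ω ∈ E i}.ncard : ℝ≥0∞) = ∑ i, (E i).indicator 1 ω := fun ω => by
    rw [Set.ncard_eq_toFinset_card', Finset.card_eq_sum_ones, Set.toFinset_ofPred,
      Finset.sum_filter]
    push_cast
    exact Finset.sum_congr rfl fun i _ => by simp [Set.indicator_apply]
  simp_rw [hcount]
  refine (meas_ge_le_lintegral_div (Finset.measurable_sum _ fun i _ =>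
    measurable_one.indicator (hE i)).aemeasurable hs hs').trans ?_
  gcongr
  rw [lintegral_finsetSum _ fun i _ => measurable_one.indicator (hE i)]
  simp_rw [lintegral_indicator_one (hE _)]
  exact (Finset.sum_le_sum fun i _ => hp i).trans (by simp)

/-- If at most a quarter of the number of blocks are outliers, then the probability that at least
half of the blocks fall into a set `T` is controlled by the probability of `T` under an i.i.d.
sample. -/
theorem IsContaminatedSample.measure_half_le {μ : Measure Ω} [IsProbabilityMeasure μ]
    {P : Measure S} {N k n m : ℕ} {Y : Fin N → Ω → S} (hY : IsContaminatedSample μ P m Y)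
    (hk : 0 < k) (hm : 4 * m ≤ k) {e : Fin k → Fin n → Fin N}
    (he : Function.Injective fun q : Fin k × Fin n => e q.1 q.2) (T : Set (Fin n → S)) :
    μ {ω | k ≤ 2 * {i | (fun l => Y (e i l) ω) ∈ T}.ncard} ≤
      4 * Measure.pi (fun _ : Fin n => P) T := by
  classical
  obtain ⟨A, X, hX, hind, hout⟩ := hY
  -- `T` will be a union over uncountably many `θ` and need not be measurable; the hull has the same
  -- measure.
  set T' := toMeasurable (Measure.pi fun _ : Fin n => P) T
  have hT' : MeasurableSet T' := measurableSet_toMeasurable _ _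
  -- Blocks meeting the reserved slots, where `X` is arbitrary, are never counted here; they are
  -- charged to the outliers.
  set E : Fin k → Set Ω := fun i =>
    if ∀ l, e i l ∉ A then (fun ω l => X (e i l) ω) ⁻¹' T' else ∅
  have hinj : ∀ i, Function.Injective (e i) := fun i l l' h =>
    (Prod.ext_iff.1 (he (a₁ := (i, l)) (a₂ := (i, l')) h)).2
  have hE : ∀ i, MeasurableSet (E i) ∧ μ (E i) ≤ Measure.pi (fun _ : Fin n => P) T := by
    intro i
    by_cases hi : ∀ l, e i l ∉ A
    · have hXm : Measurable fun ω l => X (e i l) ω := measurable_pi_lambda _ fun l => (hX _ (hi l)).1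
      have hlaw : μ.map (fun ω l => X (e i l) ω) = Measure.pi fun _ => P :=
        map_eq_pi_of_iIndepFun (fun l => (hX _ (hi l)).1) (fun l => (hX _ (hi l)).2)
          (hind.precomp (g := fun l => ⟨e i l, hi l⟩)
            fun l l' h => hinj i (congrArg Subtype.val h))
      simp only [E, if_pos hi]
      refine ⟨hXm hT', ?_⟩
      rw [← Measure.map_apply hXm hT', hlaw, measure_toMeasurable]
    · simp [E, if_neg hi]
  have hk' : (k : ℝ≥0∞) ≠ 0 := by exact_mod_cast hk.ne'
  -- Half of the blocks in `T`, minus at most a quarter hit by outliers, leaves the threshold `k /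
  -- 4`.
  have hmarkov := measure_le_card_le (fun i => (hE i).1) (fun i => (hE i).2)
    (s := k / 4) (by simp [hk']) (ENNReal.div_ne_top (by simp) (by simp))
  have hconst : (Fintype.card (Fin k) : ℝ≥0∞) * Measure.pi (fun _ : Fin n => P) T / (k / 4) =
      4 * Measure.pi (fun _ : Fin n => P) T := by
    rw [Fintype.card_fin, mul_div_assoc, ENNReal.div_eq_inv_mul, ENNReal.inv_div (by simp) (by simp),
      ← mul_assoc, ENNReal.mul_div_cancel hk' (by simp)]
  rw [hconst] at hmarkov
  refine (measure_mono_ae ?_).trans hmarkov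
  filter_upwards [hout] with ω hω hbad
  change k ≤ 2 * {i | (fun l => Y (e i l) ω) ∈ T}.ncard at hbad
  change (k / 4 : ℝ≥0∞) ≤ ({i | ω ∈ E i}.ncard : ℝ≥0∞)
  set O := {q | q ∈ A ∨ Y q ω ≠ X q ω}
  have hsub : {i | (fun l => Y (e i l) ω) ∈ T} ⊆
      {i | ω ∈ E i} ∪ {i | ∃ l, e i l ∈ O} := by
    intro i hi
    by_cases hO : ∃ l, e i l ∈ O
    · exact Or.inr hO
    · left
      simp only [O, Set.mem_ofPred_eq, not_exists, not_or, not_not] at hO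
      have hA : ∀ l, e i l ∉ A := fun l => (hO l).1
      simp only [Set.mem_ofPred_eq, E, if_pos hA, Set.mem_preimage] at hi ⊢
      refine subset_toMeasurable _ _ ?_
      simpa only [← (hO _).2] using hi
  -- Disjoint blocks hit by outliers contain distinct outliers.
  have hOcard : {i | ∃ l, e i l ∈ O}.ncard ≤ O.ncard := by
    rcases isEmpty_or_nonempty (Fin n) with hn | hn
    · simp
    choose! f hf using fun (i : Fin k) (hi : ∃ l, e i l ∈ O) => hi
    refine Set.ncard_le_ncard_of_injOn (fun i => e i (f i)) (fun i hi => hf i hi) ?_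
      (Set.toFinite _)
    intro i _ i' _ h
    exact (Prod.ext_iff.1 (he (a₁ := (i, f i)) (a₂ := (i', f i')) h)).1
  have hle := (Set.ncard_le_ncard hsub (Set.toFinite _)).trans (Set.ncard_union_le _ _)
  have hnat : k ≤ {i | ω ∈ E i}.ncard * 4 := by omega
  rw [ENNReal.div_le_iff (by simp) (by simp)]
  exact_mod_cast hnat

end Contamination

/-! ### From wells of block risks to the position of the estimators -/

section Blocks

variable {d : ℕ} {S : Type*}

theorem blockRisk_eq_average {N n : ℕ} (ℓ : EuclideanSpace ℝ (Fin d) → S → ℝ)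
    {G : Finset (Fin N)} (hG : G.card = n) (y : Fin N → S) (θ : EuclideanSpace ℝ (Fin d)) :
    blockRisk ℓ n G y θ = (∑ l, ℓ θ (y (G.orderEmbOfFin hG l))) / n := by
  rw [blockRisk]
  congr 1
  conv_lhs => rw [← Finset.map_orderEmbOfFin_univ G hG, Finset.sum_map]
  rfl

theorem injective_orderEmbOfFin_of_pairwise_disjoint {k N n : ℕ} {G : Fin k → Finset (Fin N)}
    (hG : ∀ i, (G i).card = n) (hdisj : Pairwise fun i i' => Disjoint (G i) (G i')) :
    Function.Injective fun q : Fin k × Fin n => (G q.1).orderEmbOfFin (hG q.1) q.2 := by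
  rintro ⟨i, l⟩ ⟨i', l'⟩ h
  obtain rfl : i = i' := by
    by_contra hne
    refine Finset.disjoint_left.1 (hdisj hne) (Finset.orderEmbOfFin_mem _ (hG i) l) ?_
    simp only at h
    rw [h]
    exact Finset.orderEmbOfFin_mem _ (hG i') l'
  exact Prod.ext rfl (((G i).orderEmbOfFin (hG i)).injective h)

/-- A strict majority of the block risks `b i` are at least `v - ε` on `Θ`, at least `v + η - ε`
at distance `γ` or more from `θ₀`, and at most `v + 2 ε` at distance less than `γ'` from `θ₀`. -/
def HasMajorityWell {k : ℕ} (Θ : Set (EuclideanSpace ℝ (Fin d)))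
    (b : Fin k → EuclideanSpace ℝ (Fin d) → ℝ) (θ₀ : EuclideanSpace ℝ (Fin d))
    (v γ γ' η ε : ℝ) : Prop :=
  ∃ s : Finset (Fin k), k < 2 * s.card ∧ ∀ i ∈ s, ∀ θ ∈ Θ, v - ε ≤ b i θ ∧
    (γ ≤ dist θ θ₀ → v + η - ε ≤ b i θ) ∧ (dist θ θ₀ < γ' → b i θ ≤ v + 2 * ε)

variable {k N n : ℕ} {ρ : ℝ → ℝ} {δ v γ γ' η ε : ℝ} {Θ : Set (EuclideanSpace ℝ (Fin d))}
  {ℓ : EuclideanSpace ℝ (Fin d) → S → ℝ} {G : Fin k → Finset (Fin N)} {y : Fin N → S}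
  {θ₀ θ₁ θ₂ : EuclideanSpace ℝ (Fin d)}

/-- A far minimizer would have a proxy exceeding the one at `θ₀` by at least `η - 3ε - 4δ/√n > 0`.
The majority is the same for all `θ`, so the data-dependent point `θ₁` may be inserted. -/
theorem IsRobustERM.dist_lt (hρ : AdmissibleRho ρ) (hn : 1 ≤ n) (hδ : 0 < δ) (hθ₀ : θ₀ ∈ Θ)
    (hγ' : 0 < γ') (hε : 0 < ε) (hη : 6 * ε + 4 * (δ / √(n : ℝ)) < η)
    (hb : HasMajorityWell Θ (fun i => blockRisk ℓ n (G i) y) θ₀ v γ γ' η ε)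
    (h : IsRobustERM ρ n δ Θ ℓ G y θ₁) : dist θ₁ θ₀ < γ := by
  obtain ⟨F, hF, hθ₁, hmin⟩ := h
  obtain ⟨s, hs, hw⟩ := hb
  by_contra! hfar
  have h1 := le_robustMean hρ hn hδ (hF θ₁ hθ₁) hs fun i hi => (hw i hi θ₁ hθ₁).2.1 hfar
  have h2 := robustMean_le hρ hn hδ (hF θ₀ hθ₀) hs
    fun i hi => (hw i hi θ₀ hθ₀).2.2 (by simpa using hγ')
  have h3 : F θ₁ ≤ F θ₀ := hmin hθ₀
  linarith

/-- If `θ₁` were far, the opponent `θ' = θ₀` would make its supremum at least `η - 3ε - 2δ/√n`,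
whereas the supremum for the competitor `θ₀` is at most `3ε + 2δ/√n`. This comparison dictates the
`6ε` in the hypothesis. -/
theorem IsRobustMinMax.dist_fst_lt (hρ : AdmissibleRho ρ) (hn : 1 ≤ n) (hδ : 0 < δ)
    (hθ₀ : θ₀ ∈ Θ) (hγ' : 0 < γ') (hη : 6 * ε + 4 * (δ / √(n : ℝ)) < η)
    (hb : HasMajorityWell Θ (fun i => blockRisk ℓ n (G i) y) θ₀ v γ γ' η ε)
    (h : IsRobustMinMax ρ n δ Θ ℓ G y θ₁ θ₂) : dist θ₁ θ₀ < γ := by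
  obtain ⟨F, hF, hθ₁, -, hmin, -⟩ := h
  obtain ⟨s, hs, hw⟩ := hb
  by_contra! hfar
  have hθ₀' : ∀ i ∈ s, blockRisk ℓ n (G i) y θ₀ ≤ v + 2 * ε :=
    fun i hi => (hw i hi θ₀ hθ₀).2.2 (by simpa using hγ')
  have h1 : v + η - ε - (v + 2 * ε) - 2 * (δ / √(n : ℝ)) ≤ F θ₁ θ₀ :=
    le_robustMean hρ hn hδ (hF θ₁ hθ₁ θ₀ hθ₀) hs fun i hi =>
      sub_le_sub ((hw i hi θ₁ hθ₁).2.1 hfar) (hθ₀' i hi)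
  have h2 : ∀ θ ∈ Θ, F θ₀ θ ≤ v + 2 * ε - (v - ε) + 2 * (δ / √(n : ℝ)) := fun θ hθ =>
    robustMean_le hρ hn hδ (hF θ₀ hθ₀ θ hθ) hs fun i hi =>
      sub_le_sub (hθ₀' i hi) (hw i hi θ hθ).1
  have h3 : (F θ₁ θ₀ : EReal) ≤ ((v + 2 * ε - (v - ε) + 2 * (δ / √(n : ℝ)) : ℝ) : EReal) :=
    calc (F θ₁ θ₀ : EReal) ≤ ⨆ θ' ∈ Θ, (F θ₁ θ' : EReal) :=
          le_iSup₂ (f := fun θ' (_ : θ' ∈ Θ) => (F θ₁ θ' : EReal)) θ₀ hθ₀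
      _ ≤ ⨆ θ' ∈ Θ, (F θ₀ θ' : EReal) := hmin hθ₀
      _ ≤ _ := iSup₂_le fun θ hθ => EReal.coe_le_coe_iff.2 (h2 θ hθ)
  have h4 := EReal.coe_le_coe_iff.1 h3
  linarith

/-- Once `θ₁` is so close to `θ₀` that its block risks are nearly minimal, a far `θ₂` gives a
clearly negative proxy, while the choice `θ' = θ₁` gives a proxy that is nearly 0. -/
theorem IsRobustMinMax.dist_snd_lt (hρ : AdmissibleRho ρ) (hn : 1 ≤ n) (hδ : 0 < δ)
    (hε : 0 < ε) (hη : 6 * ε + 4 * (δ / √(n : ℝ)) < η)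
    (hb : HasMajorityWell Θ (fun i => blockRisk ℓ n (G i) y) θ₀ v γ γ' η ε)
    (h : IsRobustMinMax ρ n δ Θ ℓ G y θ₁ θ₂) (hnear : dist θ₁ θ₀ < γ') : dist θ₂ θ₀ < γ := by
  obtain ⟨F, hF, hθ₁, hθ₂, -, hmax⟩ := h
  obtain ⟨s, hs, hw⟩ := hb
  by_contra! hfar
  have h1 : F θ₁ θ₂ ≤ v + 2 * ε - (v + η - ε) + 2 * (δ / √(n : ℝ)) :=
    robustMean_le hρ hn hδ (hF θ₁ hθ₁ θ₂ hθ₂) hs fun i hi =>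
      sub_le_sub ((hw i hi θ₁ hθ₁).2.2 hnear) ((hw i hi θ₂ hθ₂).2.1 hfar)
  have h2 : 0 - 2 * (δ / √(n : ℝ)) ≤ F θ₁ θ₁ :=
    le_robustMean hρ hn hδ (hF θ₁ hθ₁ θ₁ hθ₁) hs fun i _ => (sub_self _).ge
  have h3 : F θ₁ θ₁ ≤ F θ₁ θ₂ := hmax hθ₁
  linarith

end Blocks

/-! ### Wells with high probability, and convergence in probability -/

section Consistency

variable {d : ℕ} {S : Type*} [MeasurableSpace S] {P : Measure S}
  {Θ : Set (EuclideanSpace ℝ (Fin d))} {ℓ : EuclideanSpace ℝ (Fin d) → S → ℝ}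
  {θ₀ : EuclideanSpace ℝ (Fin d)}

theorem pi_exists_average_lt_le {n : ℕ} {A : Set (EuclideanSpace ℝ (Fin d))} {s t : ℝ}
    (hst : s ≤ t) :
    Measure.pi (fun _ : Fin n => P) {x | ∃ θ ∈ A, (∑ i, ℓ θ (x i)) / n < risk P ℓ θ₀ + s} ≤
      lowRiskProb P ℓ θ₀ n A t := by
  refine measure_mono fun x ⟨θ, hθ, hx⟩ => ?_
  exact (iInf₂_le (f := fun θ (_ : θ ∈ A) => (((∑ i, ℓ θ (x i)) / n : ℝ) : EReal)) θ hθ).trans_lt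
    (EReal.coe_lt_coe_iff.2 (hx.trans_le (add_le_add_right hst _)))

/-- With high probability, the empirical risk is bounded away from the minimal risk outside some
compact subset of `Θ`. -/
theorem exists_compact_eventually_pi_le (hinf : NoEscapeToInfinity P Θ ℓ θ₀)
    (hbdry : NoEscapeToBoundary P Θ ℓ θ₀) {δ : ℝ≥0∞} (hδ : δ ≠ 0) (hδ' : δ ≠ ⊤) :
    ∃ t > 0, ∃ K ⊆ Θ, IsCompact K ∧ ∀ᶠ n : ℕ in atTop, Measure.pi (fun _ : Fin n => P)
      {x | ∃ θ ∈ Θ \ K, (∑ i, ℓ θ (x i)) / n < risk P ℓ θ₀ + t} ≤ δ := by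
  have hδ2 : δ / 2 ≠ 0 := by simp [hδ]
  obtain ⟨t₁, ht₁, hlim⟩ := hinf
  obtain ⟨R, hR, hRpos⟩ := ((hlim.eventually (gt_mem_nhds hδ2.bot_lt)).and
    (eventually_gt_atTop 0)).exists
  obtain ⟨t₂, ht₂, hK⟩ := hbdry R hRpos
  -- A limsup at most `δ / 4` is strictly below `δ / 2`, hence the probabilities are eventually
  -- below `δ / 2`.
  obtain ⟨K, hKΘ, hKc, hKlim⟩ := hK (δ / 4) (ENNReal.div_pos hδ (by simp))
  have hlt : δ / 4 < δ / 2 := by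
    refine ENNReal.div_lt_div_left hδ hδ' ?_
    norm_num
  refine ⟨min t₁ t₂, lt_min ht₁ ht₂, K, hKΘ, hKc, ?_⟩
  filter_upwards [eventually_lt_of_limsup_lt hR, eventually_lt_of_limsup_lt (hKlim.trans_lt hlt)]
    with n h1 h2
  rw [← ENNReal.add_halves δ]
  refine le_trans ((measure_mono ?_).trans (measure_union_le _ _)) (add_le_add
    ((pi_exists_average_lt_le (min_le_left t₁ t₂)).trans h1.le)
    ((pi_exists_average_lt_le (min_le_right t₁ t₂)).trans h2.le))
  rintro x ⟨θ, ⟨hθ, hθK⟩, hx⟩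
  rcases le_total R ‖θ - θ₀‖ with h | h
  · exact Or.inl ⟨θ, ⟨hθ, h⟩, hx⟩
  · exact Or.inr ⟨θ, ⟨hθ, h, hθK⟩, hx⟩

/-- A continuous function with a strict minimum over `K` at `θ₀` is bounded away from its minimum
on the part of the compact set `K` outside a ball around `θ₀`. -/
theorem exists_gap_of_isCompact {f : EuclideanSpace ℝ (Fin d) → ℝ}
    {K : Set (EuclideanSpace ℝ (Fin d))} (hK : IsCompact K) (hf : ContinuousOn f K)
    (hmin : ∀ θ ∈ K, θ ≠ θ₀ → f θ₀ < f θ) {γ : ℝ} (hγ : 0 < γ) :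
    ∃ η > 0, ∀ θ ∈ K, γ ≤ dist θ θ₀ → f θ₀ + η ≤ f θ := by
  have hK' : IsCompact (K ∩ {θ | γ ≤ dist θ θ₀}) :=
    hK.inter_right (isClosed_le continuous_const (continuous_id.dist continuous_const))
  rcases (K ∩ {θ | γ ≤ dist θ θ₀}).eq_empty_or_nonempty with h | h
  · exact ⟨1, one_pos, fun θ hθ hd => (Set.eq_empty_iff_forall_notMem.1 h θ ⟨hθ, hd⟩).elim⟩
  · obtain ⟨θ, ⟨hθ, hd⟩, hθmin⟩ := hK'.exists_isMinOn h (hf.mono Set.inter_subset_left)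
    have hne : θ ≠ θ₀ := dist_pos.1 (hγ.trans_le hd)
    refine ⟨f θ - f θ₀, sub_pos.2 (hmin θ hθ hne), fun θ' hθ' hd' => ?_⟩
    have : f θ ≤ f θ' := hθmin ⟨hθ', hd'⟩
    linarith

theorem tendstoInMeasure_of_measure_le {Ω : Type*}
    [MeasurableSpace Ω] {μ : Measure Ω} {f : ℕ → Ω → EuclideanSpace ℝ (Fin d)}
    (h : ∀ γ > 0, ∀ δ : ℝ≥0∞, δ ≠ 0 → δ ≠ ⊤ → ∀ᶠ j in atTop, μ {ω | γ ≤ dist (f j ω) θ₀} ≤ δ) :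
    TendstoInMeasure μ f atTop fun _ => θ₀ := by
  rw [tendstoInMeasure_iff_dist]
  intro γ hγ
  rw [ENNReal.tendsto_nhds_zero]
  intro δ hδ
  filter_upwards [h γ hγ (min δ 1) (lt_min hδ one_pos).ne'
    ((min_le_right _ _).trans_lt ENNReal.one_lt_top).ne] with j hj
  exact hj.trans (min_le_left _ _)

variable [IsProbabilityMeasure P] {Ω : Type*} [MeasurableSpace Ω] {μ : Measure Ω}
  [IsProbabilityMeasure μ] {k n O : ℕ → ℕ} {Y : ∀ j, Fin (k j * n j) → Ω → S}
  {G : ∀ j, Fin (k j) → Finset (Fin (k j * n j))}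

/-- With high probability, most block risks have a well at `θ₀`, whose depth does not depend on
the accuracy `ε`. -/
theorem exists_eventually_measure_not_hasMajorityWell_le (hΘ : IsOpen Θ)
    (hmeas : ∀ θ ∈ Θ, Measurable (ℓ θ)) (hint : ∀ θ ∈ Θ, Integrable (ℓ θ) P) (hθ₀ : θ₀ ∈ Θ)
    (hmin : ∀ θ ∈ Θ, θ ≠ θ₀ → risk P ℓ θ₀ < risk P ℓ θ) (hlip : LipschitzLoss P Θ ℓ 0)
    (hinf : NoEscapeToInfinity P Θ ℓ θ₀) (hbdry : NoEscapeToBoundary P Θ ℓ θ₀)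
    (hk : Tendsto k atTop atTop) (hn : Tendsto n atTop atTop)
    (hG : ∀ j i, (G j i).card = n j) (hdisj : ∀ j, Pairwise fun i i' => Disjoint (G j i) (G j i'))
    (hY : ∀ j, IsContaminatedSample μ P (O j) (Y j)) (hO : ∀ᶠ j in atTop, 4 * O j ≤ k j)
    {γ : ℝ} (hγ : 0 < γ) {δ : ℝ≥0∞} (hδ : δ ≠ 0) (hδ' : δ ≠ ⊤) :
    ∃ η > 0, ∀ ε > 0, ∃ γ' > 0, ∀ᶠ j in atTop, μ {ω | ¬ HasMajorityWell Θ
      (fun i => blockRisk ℓ (n j) (G j i) fun q => Y j q ω) θ₀ (risk P ℓ θ₀) γ γ' η ε} ≤ δ := by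
  -- Two bad events, each of probability at most `δ / 8`, times the factor 4 in `measure_half_le`.
  have hδ8 : δ / 8 ≠ 0 := by simp [hδ]
  obtain ⟨t, ht, K₀, hK₀Θ, hK₀, hesc⟩ := exists_compact_eventually_pi_le hinf hbdry hδ8
    (ENNReal.div_ne_top hδ' (by simp))
  obtain ⟨r, hr, hrΘ⟩ := Metric.nhds_basis_closedBall.mem_iff.1 (hΘ.mem_nhds hθ₀)
  -- The closed ball is added so that points near `θ₀` lie in `K`, where the uniform law also gives
  -- upper bounds.
  set K := K₀ ∪ Metric.closedBall θ₀ r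
  have hK : IsCompact K := hK₀.union (isCompact_closedBall _ _)
  have hKΘ : K ⊆ Θ := Set.union_subset hK₀Θ hrΘ
  have hcont := hlip.continuousOn_risk hint
  obtain ⟨η, hη, hgap⟩ := exists_gap_of_isCompact hK (hcont.mono hKΘ)
    (fun θ hθ => hmin θ (hKΘ hθ)) hγ
  -- The gap is `η` on `K` and `t` off `K`; both are fixed before `ε`, so `ε` may later be taken as
  -- a fraction of the depth.
  refine ⟨min η t, lt_min hη ht, fun ε hε => ?_⟩
  obtain ⟨r', hr', hnear⟩ := Metric.continuousAt_iff.1 (hcont.continuousAt (hΘ.mem_nhds hθ₀)) ε hε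
  refine ⟨min r r', lt_min hr hr', ?_⟩
  set T : ∀ m : ℕ, Set (Fin m → S) := fun m =>
    {x | ∃ θ ∈ K, ε < |(∑ i, ℓ θ (x i)) / m - risk P ℓ θ|} ∪
      {x | ∃ θ ∈ Θ \ K₀, (∑ i, ℓ θ (x i)) / m < risk P ℓ θ₀ + t}
  have hunif := (hlip.tendsto_pi_uniform_deviation hmeas hint hK hKΘ hε).eventually
    (ge_mem_nhds hδ8.bot_lt)
  have hT : ∀ᶠ m : ℕ in atTop, Measure.pi (fun _ : Fin m => P) (T m) ≤ δ / 8 + δ / 8 := by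
    filter_upwards [hunif, hesc] with m h1 h2
    exact (measure_union_le _ _).trans (add_le_add h1 h2)
  have h88 : 4 * (δ / 8 + δ / 8) = δ := by
    rw [← two_mul, ← mul_assoc]
    norm_num
    exact ENNReal.mul_div_cancel (by simp) (by simp)
  filter_upwards [hn.eventually hT, hk.eventually_gt_atTop 0, hO] with j hTj hkj hOj
  have hhalf := (hY j).measure_half_le hkj hOj
    (e := fun i l => (G j i).orderEmbOfFin (hG j i) l)
    (injective_orderEmbOfFin_of_pairwise_disjoint (hG j) (hdisj j)) (T (n j))
  refine (measure_mono ?_).trans (hhalf.trans ((mul_le_mul_right hTj 4).trans h88.le))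
  intro ω hω
  by_contra hcon
  refine hω ?_
  classical
  set x : Fin (k j) → Fin (n j) → S := fun i l => Y j ((G j i).orderEmbOfFin (hG j i) l) ω
  have hcon' : 2 * {i | x i ∈ T (n j)}.ncard < k j := not_le.1 hcon
  refine ⟨Finset.univ.filter fun i => x i ∉ T (n j), ?_, fun i hi θ hθ => ?_⟩
  · have h1 := Finset.card_filter_add_card_filter_not (s := (Finset.univ : Finset (Fin (k j))))
      fun i => x i ∈ T (n j)
    rw [Set.ncard_eq_toFinset_card', Set.toFinset_ofPred] at hcon'
    rw [Finset.card_univ, Fintype.card_fin] at h1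
    omega
  · have hxi : x i ∉ T (n j) := (Finset.mem_filter.1 hi).2
    rw [Set.mem_union, not_or] at hxi
    obtain ⟨hx1, hx2⟩ := hxi
    simp only [Set.mem_ofPred_eq, not_exists, not_and, not_lt] at hx1 hx2
    beta_reduce
    rw [blockRisk_eq_average ℓ (hG j i)]
    change risk P ℓ θ₀ - ε ≤ (∑ l, ℓ θ (x i l)) / n j ∧ (_ → _ ≤ (∑ l, ℓ θ (x i l)) / n j) ∧
      (_ → (∑ l, ℓ θ (x i l)) / n j ≤ _)
    have hmin' : risk P ℓ θ₀ ≤ risk P ℓ θ := by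
      by_cases h : θ = θ₀
      · rw [h]
      · exact (hmin θ hθ h).le
    have hη1 : min η t ≤ η := min_le_left _ _
    have hη2 : min η t ≤ t := min_le_right _ _
    by_cases hθK : θ ∈ K
    · have h1 := abs_le.1 (hx1 θ hθK)
      refine ⟨by linarith, fun hd => ?_, fun hd => ?_⟩
      · linarith [hgap θ hθK hd]
      · have h2 := hnear (hd.trans_le (min_le_right _ _))
        rw [Real.dist_eq] at h2
        linarith [(abs_lt.1 h2).2]
    · have h1 := hx2 θ ⟨hθ, fun h => hθK (Or.inl h)⟩
      refine ⟨by linarith, fun _ => by linarith, fun hd => ?_⟩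
      exact (hθK (Or.inr (Metric.mem_closedBall.2 (hd.trans_le (min_le_left _ _)).le))).elim

theorem AdmissibleScaling.tendsto_div_sqrt {Δ : ℕ → ℝ} (hΔ : AdmissibleScaling Δ) :
    Tendsto (fun n : ℕ => Δ n / √(n : ℝ)) atTop (𝓝 0) :=
  hΔ.isLittleO.tendsto_div_nhds_zero

/-- The slack between `1 / 8` and `1 / 4` turns the limsup into an eventual bound. -/
theorem eventually_four_mul_le (hk : Tendsto k atTop atTop)
    (hO : limsup (fun j => (((O j : ℝ) / (k j : ℝ) : ℝ) : EReal)) atTop ≤ ((1 / 8 : ℝ) : EReal)) :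
    ∀ᶠ j in atTop, 4 * O j ≤ k j := by
  have hlt : ((1 / 8 : ℝ) : EReal) < ((1 / 4 : ℝ) : EReal) :=
    EReal.coe_lt_coe_iff.2 (by norm_num)
  filter_upwards [eventually_lt_of_limsup_lt (hO.trans_lt hlt), hk.eventually_gt_atTop 0]
    with j hj hkj
  have hkj' : (0 : ℝ) < k j := by exact_mod_cast hkj
  have h1 := EReal.coe_lt_coe_iff.1 hj
  rw [div_lt_iff₀ hkj'] at h1
  have h2 : (4 * O j : ℝ) ≤ k j := by linarith
  exact_mod_cast h2

end Consistency

end RobustMEst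

theorem theorem1 :
    ∃ c : ℝ, 0 < c ∧
      ∀ {d : ℕ} {S Ω : Type*} [MeasurableSpace S] [MeasurableSpace Ω]
        (P : Measure S) [IsProbabilityMeasure P] (μ : Measure Ω) [IsProbabilityMeasure μ]
        (Θ : Set (EuclideanSpace ℝ (Fin d))) (ℓ : EuclideanSpace ℝ (Fin d) → S → ℝ)
        (θ₀ : EuclideanSpace ℝ (Fin d)) (ρ : ℝ → ℝ) (Δ : ℕ → ℝ)
        (k n O : ℕ → ℕ)
        (Y : ∀ j, Fin (k j * n j) → Ω → S)
        (G : ∀ j, Fin (k j) → Finset (Fin (k j * n j))),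
        IsOpen Θ →
        (∀ θ ∈ Θ, Measurable (ℓ θ)) →
        (∀ θ ∈ Θ, Integrable (ℓ θ) P) →
        θ₀ ∈ Θ →
        (∀ θ ∈ Θ, θ ≠ θ₀ → RobustMEst.risk P ℓ θ₀ < RobustMEst.risk P ℓ θ) →
        RobustMEst.AdmissibleRho ρ →
        RobustMEst.AdmissibleScaling Δ →
        RobustMEst.HasPosDefHessianAt (RobustMEst.risk P ℓ) θ₀ →
        RobustMEst.LipschitzLoss P Θ ℓ 0 →
        RobustMEst.NoEscapeToInfinity P Θ ℓ θ₀ →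
        RobustMEst.NoEscapeToBoundary P Θ ℓ θ₀ →
        Monotone k → Tendsto k atTop atTop →
        Monotone n → Tendsto n atTop atTop →
        (∀ j i, (G j i).card = n j) →
        (∀ j, Pairwise fun i i' => Disjoint (G j i) (G j i')) →
        (∀ j, RobustMEst.IsContaminatedSample μ P (O j) (Y j)) →
        limsup (fun j => (((O j : ℝ) / (k j : ℝ) : ℝ) : EReal)) atTop ≤ (c : EReal) →
        ((∀ θ ∈ Θ, evariance (ℓ θ) P < ⊤) →
          ∀ θhat : ℕ → Ω → EuclideanSpace ℝ (Fin d),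
            (∀ j, ∀ᵐ ω ∂μ, RobustMEst.IsRobustERM ρ (n j) (Δ (n j)) Θ ℓ (G j)
              (fun i => Y j i ω) (θhat j ω)) →
            TendstoInMeasure μ θhat atTop (fun _ => θ₀)) ∧
        (∀ θhat₁ θhat₂ : ℕ → Ω → EuclideanSpace ℝ (Fin d),
            (∀ j, ∀ᵐ ω ∂μ, RobustMEst.IsRobustMinMax ρ (n j) (Δ (n j)) Θ ℓ (G j)
              (fun i => Y j i ω) (θhat₁ j ω) (θhat₂ j ω)) →
            TendstoInMeasure μ θhat₁ atTop (fun _ => θ₀) ∧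
            TendstoInMeasure μ θhat₂ atTop (fun _ => θ₀)) := by
  refine ⟨1 / 8, by norm_num, ?_⟩
  intro d S Ω _ _ P _ μ _ Θ ℓ θ₀ ρ Δ k n O Y G hΘ hmeas hint hθ₀ hmin hρ hΔ _ hlip hinf hbdry _ hk _
    hn hG hdisj hY hO
  have hO' := RobustMEst.eventually_four_mul_le hk hO
  have hwell := fun {γ : ℝ} (hγ : 0 < γ) {δ : ℝ≥0∞} (hδ : δ ≠ 0) (hδ' : δ ≠ ⊤) =>
    RobustMEst.exists_eventually_measure_not_hasMajorityWell_le (μ := μ) (Y := Y) hΘ hmeas hint hθ₀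
      hmin hlip hinf hbdry hk hn hG hdisj hY hO' hγ hδ hδ'
  -- With `ε = η / 12` the accuracy takes up `η / 2`, and the window width, eventually below `η /
  -- 8`, takes less than the other `η / 2`.
  have hwidth : ∀ η > 0, ∀ᶠ j in atTop, 1 ≤ n j ∧ 0 < Δ (n j) ∧
      6 * (η / 12) + 4 * (Δ (n j) / √(n j : ℝ)) < η := by
    intro η hη
    filter_upwards [(hΔ.tendsto_div_sqrt.comp hn).eventually (gt_mem_nhds (by positivity : 0 < η / 8)),
      hn.eventually_ge_atTop 1] with j h1 h2
    refine ⟨h2, hΔ.pos _ h2, ?_⟩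
    simp only [Function.comp_apply] at h1
    linarith
  refine ⟨fun _ θhat hθhat => ?_, fun θhat₁ θhat₂ hθhat => ?_⟩
  · refine RobustMEst.tendstoInMeasure_of_measure_le fun γ hγ δ hδ hδ' => ?_
    obtain ⟨η, hη, hηw⟩ := hwell hγ hδ hδ'
    obtain ⟨γ', hγ', hev⟩ := hηw (η / 12) (by positivity)
    filter_upwards [hev, hwidth η hη] with j hj ⟨hnj, hΔj, hw⟩
    refine (measure_mono_ae ?_).trans hj
    filter_upwards [hθhat j] with ω hω hfar hb
    exact not_lt.2 hfar (hω.dist_lt hρ hnj hΔj hθ₀ hγ' (by positivity) hw hb)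
  · have h₁ : TendstoInMeasure μ θhat₁ atTop fun _ => θ₀ := by
      refine RobustMEst.tendstoInMeasure_of_measure_le fun γ hγ δ hδ hδ' => ?_
      obtain ⟨η, hη, hηw⟩ := hwell hγ hδ hδ'
      obtain ⟨γ', hγ', hev⟩ := hηw (η / 12) (by positivity)
      filter_upwards [hev, hwidth η hη] with j hj ⟨hnj, hΔj, hw⟩
      refine (measure_mono_ae ?_).trans hj
      filter_upwards [hθhat j] with ω hω hfar hb
      exact not_lt.2 hfar (hω.dist_fst_lt hρ hnj hΔj hθ₀ hγ' hw hb)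
    refine ⟨h₁, RobustMEst.tendstoInMeasure_of_measure_le fun γ hγ δ hδ hδ' => ?_⟩
    have hδ2 : δ / 2 ≠ 0 := by simp [hδ]
    obtain ⟨η, hη, hηw⟩ := hwell hγ hδ2 (ENNReal.div_ne_top hδ' (by simp))
    obtain ⟨γ', hγ', hev⟩ := hηw (η / 12) (by positivity)
    -- The radius `γ'` is now fixed, so the consistency of the first coordinate applies at that
    -- scale; the two exceptional events share `δ` equally.
    filter_upwards [hev, hwidth η hη, (tendstoInMeasure_iff_dist.1 h₁ γ' hγ').eventually
      (ge_mem_nhds hδ2.bot_lt)] with j hj ⟨hnj, hΔj, hw⟩ hj₁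
    rw [← ENNReal.add_halves δ]
    refine le_trans ((measure_mono_ae ?_).trans (measure_union_le _ _)) (add_le_add hj hj₁)
    filter_upwards [hθhat j] with ω hω hfar
    by_contra hcon
    obtain ⟨hb, hnear⟩ := not_or.1 hcon
    exact not_lt.2 hfar (hω.dist_snd_lt hρ hnj hΔj (by positivity) hw (not_not.1 hb) (not_le.1 hnear))
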